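/- Let $H$ be a hypergraph on a finite vertex set $V(H)$, i.e. a collection of subsets of $V(H)$ (its edges), such that every edge has at least two elements and no edge is properly contained in another one. Let $I(H)=\{W\subseteq V(H) : W \text{ contains no edge of } H\}$ be its independence complex, and for $\sigma\subseteq V(H)$ let $\mathrm{st}(\sigma)=\{\tau\subseteq V(H) : \tau\cup\sigma\in I(H)\}$. Let $v\in V(H)$ be a vertex that - is not isolated, i.e. lies in at least one edge of $H$, and - is not a vertex of an induced Berge cycle of length $3$, i.e. there are no distinct vertices $v_1,v_2,v_3$ of $H$ with $v\in\{v_1,v_2,v_3\}$ and distinct edges $f_1,f_2,f_3$ of $H$ with $f_1\cap\{v_1,v_2,v_3\}=\{v_1,v_2\}$, $f_2\cap\{v_1,v_2,v_3\}=\{v_2,v_3\}$, $f_3\cap\{v_1,v_2,v_3\}=\{v_3,v_1\}$. Let $e_1,\dots,e_k$ be the edges of $H$ containing $v$, and $\tilde e_i=e_i\setminus\{v\}$. Then the geometric realizations satisfy $$I(H)\;\simeq\;\Sigma\Bigl(\mathrm{st}(v)\cap\bigcup_{i=1}^{k}\mathrm{st}(\tilde e_i)\Bigr),$$ where $\simeq$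 is homotopy equivalence, $\mathrm{st}(v)=\mathrm{st}(\{v\})$, and $\Sigma X$ is the unreduced suspension: two poles together with $X\times[0,1]$, where $X\times\{0\}$ is glued to one pole and $X\times\{1\}$ to the other (so $\Sigma\varnothing=S^0$ is two points). -/

import Mathlib

namespace Hypergraph

variable {α : Type*}

/-- The independence complex `I(H)`: its faces are the finite vertex sets that contain no edge
of `H`. Simplicial complexes are Mathlib's `PreAbstractSimplicialComplex`, where the empty face
is left implicit; this affects neither the geometric realization nor unions and intersections
of complexes that contain the empty face. -/
def independenceComplex (H : Hypergraph α) : PreAbstractSimplicialComplex α where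
  faces := {W | W.Nonempty ∧ (W : Set α) ⊆ H.vertexSet ∧ ∀ e ∈ H.edgeSet, ¬ e ⊆ (W : Set α)}
  isRelLowerSet_faces := by
    rintro W ⟨hne, hW, hind⟩
    refine ⟨hne, fun T hTW hT => ⟨hT, ?_, ?_⟩⟩
    · exact (Finset.coe_subset.mpr hTW).trans hW
    · exact fun e he h => hind e he (h.trans (Finset.coe_subset.mpr hTW))

/-- A Berge cycle `u₀ f₀ u₁ f₁ ⋯` of length `k` in `H`: distinct vertices `u i` and distinct edges
`f i` with `u i, u (i + 1) ∈ f i`, indices modulo `k` (addition in `Fin k` is modular). -/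
structure IsBergeCycle (H : Hypergraph α) (k : ℕ) [NeZero k]
    (u : Fin k → α) (f : Fin k → Set α) : Prop where
  vertex_injective : Function.Injective u
  edge_injective : Function.Injective f
  edge_mem : ∀ i, f i ∈ H.edgeSet
  left_mem : ∀ i, u i ∈ f i
  right_mem : ∀ i, u (i + 1) ∈ f i

/-- A Berge cycle is induced if each of its edges meets its vertex set exactly in the two
consecutive vertices, and no edge of `H` contains two non-consecutive vertices of the cycle. -/
structure IsInducedBergeCycle (H : Hypergraph α) (k : ℕ) [NeZero k]
    (u : Fin k → α) (f : Fin k → Set α) : Prop extends IsBergeCycle H k u f where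
  inter_eq : ∀ i, f i ∩ Set.range u = {u i, u (i + 1)}
  no_chord : ∀ i j, i ≠ j → j ≠ i + 1 → i ≠ j + 1 → ∀ e ∈ H.edgeSet, ¬ (u i ∈ e ∧ u j ∈ e)

end Hypergraph

namespace PreAbstractSimplicialComplex

variable {α : Type*}

/-- The closed star `st_X(σ)`, the complex of all `τ` such that `τ ∪ σ` is a face of `X`. -/
def closedStar (X : PreAbstractSimplicialComplex α) (σ : Set α) :
    PreAbstractSimplicialComplex α where
  faces := {τ | τ.Nonempty ∧ ∃ ρ ∈ X.faces, (ρ : Set α) = (τ : Set α) ∪ σ}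
  isRelLowerSet_faces := by
    classical
    rintro τ ⟨hτ, ρ, hρ, hρτ⟩
    refine ⟨hτ, fun T hT hTne => ⟨hTne, ρ.filter (fun a => a ∈ T ∨ a ∈ σ), ?_, ?_⟩⟩
    · refine (X.isRelLowerSet_faces hρ).2 (Finset.filter_subset _ _) ?_
      obtain ⟨a, ha⟩ := hTne
      refine ⟨a, Finset.mem_filter.mpr ⟨?_, Or.inl ha⟩⟩
      have : a ∈ (ρ : Set α) := hρτ ▸ Or.inl (hT ha)
      exact this
    · ext a
      have h : a ∈ ρ ↔ a ∈ τ ∨ a ∈ σ := by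
        rw [← Finset.mem_coe, hρτ]; simp
      simp only [Finset.coe_filter, Set.mem_ofPred_eq, Set.mem_union, Finset.mem_coe, h]
      have := @hT a
      tauto

/-- The geometric realization in barycentric coordinates: all `x : α → ℝ` with nonnegative
coordinates that sum to `1` and whose support lies in a face. With the product topology of `α → ℝ`
this is the usual realization of a complex that has finitely many vertices. -/
def realization (X : PreAbstractSimplicialComplex α) : Set (α → ℝ) :=
  {x | (∀ a, 0 ≤ x a) ∧ ∃ s ∈ X.faces, Function.support x ⊆ (s : Set α) ∧ ∑ a ∈ s, x a = 1}

end PreAbstractSimplicialComplex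

/-- The gluing relation of the suspension: the bottom `X × {0}` is attached to the pole `false`
and the top `X × {1}` to the pole `true`. -/
inductive Suspension.Rel (X : Type*) : (X × unitInterval) ⊕ Bool → (X × unitInterval) ⊕ Bool → Prop
  | bottom (x : X) : Suspension.Rel X (Sum.inl (x, 0)) (Sum.inr false)
  | top (x : X) : Suspension.Rel X (Sum.inl (x, 1)) (Sum.inr true)

/-- The (unreduced) suspension `ΣX`. For nonempty `X` it is `X × [0, 1]` with `X × {0}` and `X × {1}`
each identified to a point; for empty `X` the two poles remain, so that `Σ∅ = S⁰`. -/
def Suspension (X : Type*) : Type _ := Quot (Suspension.Rel X)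

/-- The suspension carries the quotient topology. -/
instance Suspension.instTopologicalSpace (X : Type*) [TopologicalSpace X] :
    TopologicalSpace (Suspension X) :=
  inferInstanceAs (TopologicalSpace (Quot (Suspension.Rel X)))

/-!
Write `X = I(H)`, and let `A` be the star of `v` and `B` the union of the stars of the sets
`e \ {v}`, where `e` runs over the edges through `v`. A face `s` of `X` outside of `A` becomes
dependent when `v` is added, so `s ∪ {v}` contains an edge `e` through `v`, and then `s` lies in the
star of `e \ {v}`. Hence `X = A ∪ B`. If `A` and `B` are both contractible, then `X` is the
suspension of `A ∩ B` up to homotopy (`nonempty_homotopyEquiv_suspension`, and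
`nonempty_homotopyEquiv_suspension_inf` for complexes).

The star `A` is a cone with apex `v`. For `B`, the absence of induced Berge cycles of length `3`
through `v` gives a flag-like property: a set that is independent together with each of several
`e \ {v}` is independent together with their union
(`union_biUnion_mem_faces_independenceComplex`). So all intersections of the stars are again stars
of faces, and `B` is contractible as in the nerve lemma. Here this is done by an explicit homotopy
(`contractibleSpace_iSup_closedStar`): small coordinates of a point of `B` are truncated to `0`,
the truncated point moves to a convex combination of chosen vertices `u e ∈ e \ {v}`, weighted by
closeness to the star of `e \ {v}`, and all these combinations lie in one simplex of `B`.
-/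

open Topology

section Gluing

open unitInterval

/-! ### Suspensions -/

namespace Suspension

variable {L : Type*}

/-- The two poles of a suspension; `false` is the pole at height `0`, `true` the one at height
`1`. -/
def pole (L : Type*) (i : Bool) : Suspension L := Quot.mk _ (Sum.inr i)

/-- The point of the suspension over `x` at height `t`, where `t` is a real number that is
truncated to `[0, 1]`. Hence all `t ≤ 0` give one pole and all `t ≥ 1` the other. -/
noncomputable def point (t : ℝ) (x : L) : Suspension L :=
  Quot.mk _ (Sum.inl (x, Set.projIcc 0 1 zero_le_one t))

lemma point_of_nonpos {t : ℝ} (ht : t ≤ 0) (x : L) : point t x = pole L false := by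
  rw [point, Set.projIcc_of_le_left _ ht]
  exact Quot.sound (Rel.bottom x)

lemma point_of_one_le {t : ℝ} (ht : 1 ≤ t) (x : L) : point t x = pole L true := by
  rw [point, Set.projIcc_of_right_le _ ht]
  exact Quot.sound (Rel.top x)

lemma exists_pole_or_point (z : Suspension L) :
    (∃ i, z = pole L i) ∨ ∃ t x, z = point t x := by
  induction z using Quot.ind with
  | mk z =>
    rcases z with ⟨x, t⟩ | i
    · refine Or.inr ⟨t, x, ?_⟩
      rw [point, Set.projIcc_val]
    · exact Or.inl ⟨i, rfl⟩

variable {Y Z : Type*} [TopologicalSpace L] [TopologicalSpace Y] [TopologicalSpace Z]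

lemma isQuotientMap_mk : IsQuotientMap (Quot.mk (Rel L) : _ → Suspension L) :=
  isQuotientMap_quot_mk

lemma continuous_point : Continuous fun p : ℝ × L => point p.1 p.2 := by
  unfold point
  refine isQuotientMap_mk.continuous.comp (continuous_inl.comp ?_)
  exact continuous_snd.prodMk (continuous_projIcc.comp continuous_fst)

/-- A family of maps out of a suspension, parametrized by a locally compact space `Y`, may be
given on `ℝ × L` as long as it is constant below height `0` and above height `1`. The values
`p`, `q` at the poles are data because `L` may be empty. -/
lemma exists_lift [LocallyCompactSpace Y] (M : Y → ℝ → L → Z)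
    (hM : Continuous fun a : Y × ℝ × L => M a.1 a.2.1 a.2.2) (p : Bool → C(Y, Z))
    (h0 : ∀ y t x, t ≤ 0 → M y t x = p false y) (h1 : ∀ y t x, 1 ≤ t → M y t x = p true y) :
    ∃ F : C(Y × Suspension L, Z),
      (∀ y t x, F (y, point t x) = M y t x) ∧ ∀ y i, F (y, pole L i) = p i y := by
  let F₀ : Y → (L × I) ⊕ Bool → Z := fun y => Sum.elim (fun a => M y a.2 a.1) (fun i => p i y)
  have hF₀ : ∀ y a b, Rel L a b → F₀ y a = F₀ y b := by
    rintro y _ _ (x | x)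
    · exact h0 y _ x le_rfl
    · exact h1 y _ x le_rfl
  let F : Y × Suspension L → Z := fun a => Quot.lift (F₀ a.1) (hF₀ a.1) a.2
  have hF : Continuous F := by
    refine isQuotientMap_mk.continuous_lift_prod_right ?_
    have : (fun a : Y × ((L × I) ⊕ Bool) => F (a.1, Quot.mk _ a.2)) =
        Sum.elim (fun a : Y × L × I => M a.1 a.2.2 a.2.1) (fun a : Y × Bool => p a.2 a.1) ∘
          Homeomorph.prodSumDistrib := by
      funext ⟨y, a⟩
      rcases a with a | i <;> rfl
    rw [this]
    refine (Continuous.sumElim ?_ ?_).comp (Homeomorph.continuous _)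
    · exact hM.comp (continuous_fst.prodMk
        ((continuous_subtype_val.comp (continuous_snd.comp continuous_snd)).prodMk
          (continuous_fst.comp continuous_snd)))
    · exact continuous_prod_of_discrete_right.mpr fun i => (p i).continuous
  refine ⟨⟨F, hF⟩, fun y t x => ?_, fun y i => rfl⟩
  change M y (Set.projIcc (0 : ℝ) 1 zero_le_one t) x = M y t x
  rcases le_total t 0 with ht | ht
  · rw [Set.projIcc_of_le_left _ ht, h0 y t x ht, h0 y _ x le_rfl]
  rcases le_total 1 t with ht' | ht'
  · rw [Set.projIcc_of_right_le _ ht', h1 y t x ht', h1 y _ x le_rfl]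
  · rw [Set.projIcc_of_mem _ ⟨ht, ht'⟩]

end Suspension

/-! ### Gluing two contractible subspaces -/

/-- A contraction of a contractible space, with time extended to all of `ℝ`: the base point at
times `τ ≤ 0` and the identity at times `τ ≥ 1`. -/
lemma ContractibleSpace.exists_contraction (A : Type*) [TopologicalSpace A] [ContractibleSpace A] :
    ∃ (p : A) (c : ℝ → A → A), (Continuous fun a : ℝ × A => c a.1 a.2) ∧
      (∀ τ x, τ ≤ 0 → c τ x = p) ∧ ∀ τ x, 1 ≤ τ → c τ x = x := by
  obtain ⟨p, ⟨H⟩⟩ := id_nullhomotopic A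
  refine ⟨p, fun τ x => H.symm (Set.projIcc 0 1 zero_le_one τ, x), ?_, ?_, ?_⟩
  · exact H.symm.continuous.comp
      ((continuous_projIcc.comp continuous_fst).prodMk continuous_snd)
  · intro τ x hτ
    beta_reduce
    rw [Set.projIcc_of_le_left _ hτ]
    exact H.symm.apply_zero x
  · intro τ x hτ
    beta_reduce
    rw [Set.projIcc_of_right_le _ hτ]
    exact H.symm.apply_one x

/-- Families of continuous maps on two closed sets that cover the space can be glued. -/
lemma exists_glue {X Y Z : Type*} [TopologicalSpace X] [TopologicalSpace Y] [TopologicalSpace Z]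
    {A B : Set X} (hA : IsClosed A) (hB : IsClosed B) (hAB : ∀ x, x ∈ A ∨ x ∈ B)
    (φ : C(Y × A, Z)) (ψ : C(Y × B, Z))
    (h : ∀ y x (ha : x ∈ A) (hb : x ∈ B), φ (y, ⟨x, ha⟩) = ψ (y, ⟨x, hb⟩)) :
    ∃ F : C(Y × X, Z), (∀ y x (ha : x ∈ A), F (y, x) = φ (y, ⟨x, ha⟩)) ∧
      ∀ y x (hb : x ∈ B), F (y, x) = ψ (y, ⟨x, hb⟩) := by
  classical
  let F : Y × X → Z := fun a =>
    if ha : a.2 ∈ A then φ (a.1, ⟨a.2, ha⟩) else ψ (a.1, ⟨a.2, (hAB a.2).resolve_left ha⟩)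
  have hFA : ∀ y x (ha : x ∈ A), F (y, x) = φ (y, ⟨x, ha⟩) := fun y x ha => dif_pos ha
  have hFB : ∀ y x (hb : x ∈ B), F (y, x) = ψ (y, ⟨x, hb⟩) := by
    intro y x hb
    by_cases ha : x ∈ A
    · rw [hFA y x ha, h y x ha hb]
    · exact dif_neg ha
  refine ⟨⟨F, ?_⟩, hFA, hFB⟩
  rw [← continuousOn_univ]
  have hcover : (Set.univ : Set (Y × X)) = Prod.snd ⁻¹' A ∪ Prod.snd ⁻¹' B := by
    ext ⟨y, x⟩
    simpa using hAB x
  rw [hcover]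
  refine ContinuousOn.union_of_isClosed ?_ ?_ (hA.preimage continuous_snd)
    (hB.preimage continuous_snd)
  · rw [continuousOn_iff_continuous_domRestrict]
    have : (Prod.snd ⁻¹' A).domRestrict F = fun a : (Prod.snd ⁻¹' A : Set (Y × X)) =>
        φ (a.1.1, ⟨a.1.2, a.2⟩) := by
      funext ⟨⟨y, x⟩, ha⟩
      exact hFA y x ha
    rw [this]
    fun_prop
  · rw [continuousOn_iff_continuous_domRestrict]
    have : (Prod.snd ⁻¹' B).domRestrict F = fun a : (Prod.snd ⁻¹' B : Set (Y × X)) =>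
        ψ (a.1.1, ⟨a.1.2, a.2⟩) := by
      funext ⟨⟨y, x⟩, hb⟩
      exact hFB y x hb
    rw [this]
    fun_prop

/-- Let `T` map the part `b < 1` of `A` to `L`, and let `γ` be a cone over `L` whose
apex `p` is reached at heights `u ≤ 0`. Then `A` maps to the cone, the points with `b = 0` to
the level `1 / 2` and those with `b ≥ 1 / 2` to the apex. The parameter `k` shrinks this map to
the apex. -/
lemma exists_map_to_cone {A L P : Type*} [TopologicalSpace A] [TopologicalSpace L]
    [TopologicalSpace P] (b : C(A, ℝ)) (T : C({y // b y < 1}, L)) (γ : ℝ → L → P)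
    (hγ : Continuous fun a : ℝ × L => γ a.1 a.2) (p : P) (hp : ∀ u x, u ≤ 0 → γ u x = p) :
    ∃ Γ : C(I × A, P), (∀ (k : I) y (h : b y < 1), Γ (k, y) = γ (k * (1 / 2 - b y)) (T ⟨y, h⟩)) ∧
      ∀ k y, 1 / 2 ≤ b y → Γ (k, y) = p := by
  classical
  let F : I × A → P := fun a =>
    if h : b a.2 < 1 then γ (a.1 * (1 / 2 - b a.2)) (T ⟨a.2, h⟩) else p
  have hF1 : ∀ (k : I) y (h : b y < 1), F (k, y) = γ (k * (1 / 2 - b y)) (T ⟨y, h⟩) :=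
    fun k y h => dif_pos h
  have hF2 : ∀ k y, 1 / 2 ≤ b y → F (k, y) = p := by
    intro k y h
    by_cases h' : b y < 1
    · rw [hF1 k y h']
      exact hp _ _ (mul_nonpos_of_nonneg_of_nonpos k.2.1 (by linarith))
    · exact dif_neg h'
  refine ⟨⟨F, ?_⟩, hF1, hF2⟩
  rw [continuous_iff_continuousAt]
  rintro ⟨k, y⟩
  have hb : Continuous fun a : I × A => b a.2 := b.continuous.comp continuous_snd
  by_cases h : b y < 1
  · have ho : IsOpen {a : I × A | b a.2 < 1} := isOpen_lt hb continuous_const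
    refine ContinuousOn.continuousAt (s := {a : I × A | b a.2 < 1}) ?_ (ho.mem_nhds h)
    rw [continuousOn_iff_continuous_domRestrict]
    have : Set.domRestrict {a : I × A | b a.2 < 1} F = fun a : {a : I × A | b a.2 < 1} =>
        γ (a.1.1 * (1 / 2 - b a.1.2)) (T ⟨a.1.2, a.2⟩) := by
      funext ⟨⟨k, y⟩, h⟩
      exact hF1 k y h
    rw [this]
    refine hγ.comp (Continuous.prodMk ?_ ?_) <;> fun_prop
  · have ho : IsOpen {a : I × A | 1 / 2 < b a.2} := isOpen_lt continuous_const hb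
    refine ContinuousAt.congr (f := fun _ => p) continuousAt_const ?_
    have hmem : (k, y) ∈ {a : I × A | 1 / 2 < b a.2} := by
      change 1 / 2 < b y
      linarith
    filter_upwards [ho.mem_nhds hmem] with a ha
    exact (hF2 a.1 a.2 (le_of_lt ha)).symm

lemma Topology.IsEmbedding.exists_continuousMap_lift {X Y L : Type*} [TopologicalSpace X]
    [TopologicalSpace Y] [TopologicalSpace L] {ι : L → X} (hι : IsEmbedding ι) {f : Y → X}
    (hf : Continuous f) (h : ∀ y, f y ∈ Set.range ι) : ∃ f' : C(Y, L), ∀ y, ι (f' y) = f y := by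
  choose f' hf' using h
  refine ⟨⟨f', hι.continuous_iff.mpr ?_⟩, hf'⟩
  rwa [show ι ∘ f' = f from funext hf']

lemma continuous_ite_half {Y L W : Type*} [TopologicalSpace Y] [TopologicalSpace L]
    [TopologicalSpace W] (P Q : Y → ℝ → L → W)
    (hP : Continuous fun p : Y × ℝ × L => P p.1 p.2.1 p.2.2)
    (hQ : Continuous fun p : Y × ℝ × L => Q p.1 p.2.1 p.2.2) (h : ∀ y x, P y 1 x = Q y 1 x) :
    Continuous fun p : Y × ℝ × L =>
      if p.2.1 ≤ 1 / 2 then P p.1 (2 * p.2.1) p.2.2 else Q p.1 (2 - 2 * p.2.1) p.2.2 := by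
  refine Continuous.if_le
    (hP.comp (f := fun p : Y × ℝ × L => (p.1, 2 * p.2.1, p.2.2)) (by fun_prop))
    (hQ.comp (f := fun p : Y × ℝ × L => (p.1, 2 - 2 * p.2.1, p.2.2)) (by fun_prop))
    (by fun_prop) (by fun_prop) ?_
  rintro ⟨y, t, x⟩ ht
  simp only at ht
  subst ht
  norm_num [h]

/-- A space covered by two contractible closed subspaces `A`, `B` is homotopy equivalent to the
suspension of `A ∩ B`, provided that `A ∩ B` has a neighborhood that can be pushed into it: `a` and
`b` vanish exactly on `A` and on `B`, and some `T`, homotopic to the identity through maps that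
preserve `A` and `B`, sends `a < 1` into `A` and `b < 1` into `B`. The intersection is given as an
embedded space `ι : L → X`.

The map `g : X → ΣL` sends `x` to the point over `T x` at a height that is `1 / 2` on the
intersection and reaches the poles away from it. The map `f : ΣL → X` follows the contraction of `A`
on the lower half and the contraction of `B` on the upper half. Both composites preserve the
halves, and on the intersection they are `T`, so each half can be deformed by its own contraction,
damped so that it does not move the intersection. -/
theorem nonempty_homotopyEquiv_suspension {X L : Type*} [TopologicalSpace X] [TopologicalSpace L]
    (A B : Set X) [ContractibleSpace A] [ContractibleSpace B] (hAB : ∀ x, x ∈ A ∨ x ∈ B)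
    (ι : L → X) (hι : IsEmbedding ι) (hr : Set.range ι = A ∩ B)
    (a b : C(X, ℝ)) (ha' : ∀ x, 0 ≤ a x) (hb' : ∀ x, 0 ≤ b x)
    (ha : ∀ x, x ∈ A ↔ a x = 0) (hb : ∀ x, x ∈ B ↔ b x = 0)
    (T : C(X, X)) (D : (ContinuousMap.id X).Homotopy T)
    (hDA : ∀ s x, x ∈ A → D (s, x) ∈ A) (hDB : ∀ s x, x ∈ B → D (s, x) ∈ B)
    (hTA : ∀ x, a x < 1 → T x ∈ A) (hTB : ∀ x, b x < 1 → T x ∈ B) :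
    Nonempty (ContinuousMap.HomotopyEquiv X (Suspension L)) := by
  classical
  have hAc : IsClosed A := by
    have : A = a ⁻¹' {0} := Set.ext ha
    exact this ▸ isClosed_singleton.preimage a.continuous
  have hBc : IsClosed B := by
    have : B = b ⁻¹' {0} := Set.ext hb
    exact this ▸ isClosed_singleton.preimage b.continuous
  have hιA : ∀ x, ι x ∈ A := fun x => (hr ▸ Set.mem_range_self x : ι x ∈ A ∩ B).1
  have hιB : ∀ x, ι x ∈ B := fun x => (hr ▸ Set.mem_range_self x : ι x ∈ A ∩ B).2
  have lift : ∀ y, y ∈ A → y ∈ B → y ∈ Set.range ι := fun y hA hB => hr ▸ ⟨hA, hB⟩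
  have hT1 : ∀ x, D (1, x) = T x := D.apply_one
  have hTAA : ∀ x ∈ A, T x ∈ A := fun x hx => hT1 x ▸ hDA 1 x hx
  have hTBB : ∀ x ∈ B, T x ∈ B := fun x hx => hT1 x ▸ hDB 1 x hx
  obtain ⟨TA, hTA'⟩ := hι.exists_continuousMap_lift
    (f := fun y : {y : A // b y < 1} => T y.1.1) (by fun_prop)
    (fun y => lift _ (hTAA _ y.1.2) (hTB _ y.2))
  obtain ⟨TB, hTB'⟩ := hι.exists_continuousMap_lift
    (f := fun y : {y : B // a y < 1} => T y.1.1) (by fun_prop)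
    (fun y => lift _ (hTA _ y.2) (hTBB _ y.1.2))
  obtain ⟨DL, hDL⟩ := hι.exists_continuousMap_lift
    (f := fun y : I × L => D (y.1, ι y.2))
    (D.continuous.comp (continuous_fst.prodMk (hι.continuous.comp continuous_snd)))
    (fun y => lift _ (hDA _ _ (hιA _)) (hDB _ _ (hιB _)))
  have hTAL : ∀ x h, TA ⟨⟨ι x, hιA x⟩, h⟩ = DL (1, x) := fun x h =>
    hι.injective (by rw [hTA', hDL, hT1])
  have hTBL : ∀ x h, TB ⟨⟨ι x, hιB x⟩, h⟩ = DL (1, x) := fun x h =>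
    hι.injective (by rw [hTB', hDL, hT1])
  have hDL0 : ∀ x, DL (0, x) = x := fun x => hι.injective (by rw [hDL]; exact D.apply_zero _)
  obtain ⟨pA, cA, hcA, hcA0, hcA1⟩ := ContractibleSpace.exists_contraction A
  obtain ⟨pB, cB, hcB, hcB0, hcB1⟩ := ContractibleSpace.exists_contraction B
  -- `A` and `B` are mapped to the lower and the upper half of the suspension.
  obtain ⟨ΓA, hΓA, hΓA'⟩ := exists_map_to_cone ⟨fun y : A => b y, by fun_prop⟩ TA
    (fun u x => Suspension.point u x) Suspension.continuous_point (Suspension.pole L false)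
    (fun u x hu => Suspension.point_of_nonpos hu x)
  obtain ⟨ΓB, hΓB, hΓB'⟩ := exists_map_to_cone ⟨fun y : B => a y, by fun_prop⟩ TB
    (fun u x => Suspension.point (1 - u) x)
    (Suspension.continuous_point.comp (f := fun a : ℝ × L => (1 - a.1, a.2)) (by fun_prop))
    (Suspension.pole L true)
    (fun u x hu => Suspension.point_of_one_le (by linarith) x)
  simp only [ContinuousMap.coe_mk] at hΓA hΓA' hΓB hΓB'
  have hΓAL : ∀ (k : I) x, ΓA (k, ⟨ι x, hιA x⟩) = Suspension.point (k / 2) (DL (1, x)) := by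
    intro k x
    have h0 : b (ι x) = 0 := (hb _).1 (hιB x)
    rw [hΓA k _ (by simp [h0]), hTAL]
    simp only [h0]
    congr 1
    ring
  have hΓBL : ∀ (k : I) x, ΓB (k, ⟨ι x, hιB x⟩) = Suspension.point (1 - k / 2) (DL (1, x)) := by
    intro k x
    have h0 : a (ι x) = 0 := (ha _).1 (hιA x)
    rw [hΓB k _ (by simp [h0]), hTBL]
    simp only [h0]
    congr 1
    ring
  have hΓA0 : ∀ y, ΓA (0, y) = Suspension.pole L false := by
    intro y
    rcases lt_or_ge (b y) 1 with h | h
    · rw [hΓA _ _ h]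
      exact Suspension.point_of_nonpos (by simp) _
    · exact hΓA' _ _ (by linarith)
  have hΓB0 : ∀ y, ΓB (0, y) = Suspension.pole L true := by
    intro y
    rcases lt_or_ge (a y) 1 with h | h
    · rw [hΓB _ _ h]
      exact Suspension.point_of_one_le (by simp) _
    · exact hΓB' _ _ (by linarith)
  have hL : ∀ x, x ∈ A → x ∈ B → ∃ l, ι l = x := fun x hxA hxB => by
    have : x ∈ Set.range ι := hr ▸ ⟨hxA, hxB⟩
    exact this
  obtain ⟨g₀, hgA, hgB⟩ := exists_glue (Y := Unit) hAc hBc hAB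
    ⟨fun y => ΓA (1, y.2), by fun_prop⟩ ⟨fun y => ΓB (1, y.2), by fun_prop⟩ (by
      intro _ x hxA hxB
      obtain ⟨l, rfl⟩ := hL x hxA hxB
      simp only [ContinuousMap.coe_mk]
      rw [hΓAL, hΓBL]
      norm_num)
  simp only [ContinuousMap.coe_mk] at hgA hgB
  let g : C(X, Suspension L) := ⟨fun x => g₀ ((), x), by fun_prop⟩
  -- The map back runs along the contractions of `A` and `B`.
  let jA : L → A := fun x => ⟨ι x, hιA x⟩
  let jB : L → B := fun x => ⟨ι x, hιB x⟩
  have hjA : Continuous jA := hι.continuous.subtype_mk _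
  have hjB : Continuous jB := hι.continuous.subtype_mk _
  obtain ⟨f₀, hf, hfp⟩ := Suspension.exists_lift (Y := Unit) (L := L) (Z := X)
    (fun _ t x => if t ≤ 1 / 2 then (cA (2 * t) (jA x) : X) else (cB (2 - 2 * t) (jB x) : X))
    (continuous_ite_half (fun _ τ x => (cA τ (jA x) : X)) (fun _ τ x => (cB τ (jB x) : X))
      (continuous_subtype_val.comp
        (hcA.comp (f := fun p : Unit × ℝ × L => (p.2.1, jA p.2.2)) (by fun_prop)))
      (continuous_subtype_val.comp
        (hcB.comp (f := fun p : Unit × ℝ × L => (p.2.1, jB p.2.2)) (by fun_prop)))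
      (by intro _ x; rw [hcA1 _ _ le_rfl, hcB1 _ _ le_rfl]))
    (fun i => ContinuousMap.const _ (bif i then (pB : X) else pA))
    (by
      intro _ t x ht
      rw [if_pos (by linarith), hcA0 _ _ (by linarith)]
      rfl)
    (by
      intro _ t x ht
      rw [if_neg (by linarith), hcB0 _ _ (by linarith)]
      rfl)
  have hfA : ∀ t x, t ≤ 1 / 2 → f₀ ((), Suspension.point t x) = cA (2 * t) (jA x) :=
    fun t x ht => by rw [hf, if_pos ht]
  have hfB : ∀ t x, 1 / 2 ≤ t → f₀ ((), Suspension.point t x) = cB (2 - 2 * t) (jB x) := by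
    intro t x ht
    rcases ht.eq_or_lt with rfl | ht
    · rw [hfA _ _ le_rfl, hcA1 _ _ (by norm_num), hcB1 _ _ (by norm_num)]
    · rw [hf, if_neg (by linarith)]
  let f : C(Suspension L, X) := ⟨fun z => f₀ ((), z), by fun_prop⟩
  -- The composite on `X` is homotopic to `T`, with `T x` moved along the contractions.
  have hfg : (f.comp g).Homotopic T := by
    obtain ⟨G, hGA, hGB⟩ := exists_glue (Y := I) (Z := X) hAc hBc hAB
      ⟨fun y => cA (1 - 2 * (1 - y.1) * b y.2) ⟨T y.2, hTAA _ y.2.2⟩,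
        continuous_subtype_val.comp (hcA.comp (Continuous.prodMk (by fun_prop)
          (Continuous.subtype_mk (by fun_prop) _)))⟩
      ⟨fun y => cB (1 - 2 * (1 - y.1) * a y.2) ⟨T y.2, hTBB _ y.2.2⟩,
        continuous_subtype_val.comp (hcB.comp (Continuous.prodMk (by fun_prop)
          (Continuous.subtype_mk (by fun_prop) _)))⟩
      (by
        intro s x hxA hxB
        simp only [ContinuousMap.coe_mk]
        rw [hcA1 _ _ (by simp [(hb x).1 hxB]), hcB1 _ _ (by simp [(ha x).1 hxA])])
    simp only [ContinuousMap.coe_mk] at hGA hGB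
    refine ⟨⟨G, fun x => ?_, fun x => ?_⟩⟩
    · change G (0, x) = f₀ ((), g₀ ((), x))
      rcases hAB x with hx | hx
      · rw [hGA _ _ hx, hgA _ _ hx]
        have hb0 : 0 ≤ b x := hb' x
        rcases lt_or_ge (b x) 1 with h | h
        · rw [hΓA _ _ h, hfA _ _ (by simp [hb0])]
          congr 2
          · simp
            ring
          · exact Subtype.ext (hTA' ⟨⟨x, hx⟩, h⟩).symm
        · rw [hΓA' _ _ (by linarith), hfp, hcA0 _ _ (by simp; linarith)]
          rfl
      · rw [hGB _ _ hx, hgB _ _ hx]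
        have ha0 : 0 ≤ a x := ha' x
        rcases lt_or_ge (a x) 1 with h | h
        · rw [hΓB _ _ h, hfB _ _ (by simp; linarith)]
          congr 2
          · simp
            ring
          · exact Subtype.ext (hTB' ⟨⟨x, hx⟩, h⟩).symm
        · rw [hΓB' _ _ (by linarith), hfp, hcB0 _ _ (by simp; linarith)]
          rfl
    · change G (1, x) = T x
      rcases hAB x with hx | hx
      · rw [hGA _ _ hx, hcA1 _ _ (by simp)]
      · rw [hGB _ _ hx, hcB1 _ _ (by simp)]
  have hgf : (g.comp f).Homotopic (ContinuousMap.id _) := by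
    -- The factor `k s τ` shrinks the image of level `τ` towards the pole, but leaves the equator
    -- `τ = 1` alone. At `s = 1` it has collapsed all levels `τ ≤ 1 / 2`, and the factor `1 + s` has
    -- run the contraction to its end on the others, so that only `T` on the intersection is left.
    let k : I → ℝ → I := fun s τ => Set.projIcc 0 1 zero_le_one (1 - s * min 1 (2 - 2 * τ))
    have hk : Continuous fun p : I × ℝ => k p.1 p.2 := continuous_projIcc.comp (by fun_prop)
    have hk0 : ∀ τ, k 0 τ = 1 := fun τ => by
      simp only [k]
      rw [Set.projIcc_of_right_le] <;> simp
    have hk1 : ∀ s τ, 1 ≤ τ → k s τ = 1 := fun s τ hτ => by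
      refine Set.projIcc_of_right_le _ ?_
      have := mul_nonpos_of_nonneg_of_nonpos s.2.1
        ((min_le_right 1 (2 - 2 * τ)).trans (by linarith))
      linarith
    have hk2 : ∀ s τ, τ ≤ 0 → k s τ = σ s := fun s τ hτ => by
      simp only [k]
      rw [min_eq_left (by linarith), mul_one]
      exact Set.projIcc_val zero_le_one (σ s)
    have hk3 : ∀ τ, τ ≤ 1 / 2 → k 1 τ = 0 := fun τ hτ => by
      simp only [k]
      rw [min_eq_left (by linarith)]
      exact Set.projIcc_of_le_left _ (by simp)
    have hk4 : ∀ τ, 1 / 2 ≤ τ → τ ≤ 1 → (k 1 τ : ℝ) = 2 * τ - 1 := fun τ hτ hτ' => by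
      simp only [k]
      rw [min_eq_right (by linarith), Set.projIcc_of_mem _ (by simp; constructor <;> linarith)]
      simp
      ring
    have hkc : ∀ {C : Set X} (c : ℝ → C → C) (Γ : C(I × C, Suspension L)) (j : L → C),
        (Continuous fun p : ℝ × C => c p.1 p.2) → Continuous j →
        Continuous fun p : I × ℝ × L =>
          Γ (k p.1 p.2.1, c ((1 + p.1) * p.2.1) (j p.2.2)) := by
      intro C c Γ j hc hj
      refine Γ.continuous.comp (Continuous.prodMk ?_ ?_)
      · exact hk.comp (f := fun p : I × ℝ × L => (p.1, p.2.1)) (by fun_prop)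
      · exact hc.comp
          (f := fun p : I × ℝ × L => ((1 + (p.1 : ℝ)) * p.2.1, j p.2.2)) (by fun_prop)
    obtain ⟨Φ, hΦ, hΦp⟩ := Suspension.exists_lift (Y := I) (L := L) (Z := Suspension L)
      (fun s t x => if t ≤ 1 / 2 then ΓA (k s (2 * t), cA ((1 + s) * (2 * t)) (jA x)) else
        ΓB (k s (2 - 2 * t), cB ((1 + s) * (2 - 2 * t)) (jB x)))
      (continuous_ite_half (fun (s : I) τ x => ΓA (k s τ, cA ((1 + s) * τ) (jA x)))
        (fun (s : I) τ x => ΓB (k s τ, cB ((1 + s) * τ) (jB x)))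
        (hkc cA ΓA jA hcA hjA) (hkc cB ΓB jB hcB hjB)
        (by
          intro s x
          have hs := s.2.1
          rw [hcA1 _ _ (by linarith), hcB1 _ _ (by linarith), hk1 _ _ le_rfl, hΓAL, hΓBL]
          norm_num))
      (fun i => bif i then ⟨fun s => ΓB (σ s, pB), by fun_prop⟩ else
        ⟨fun s => ΓA (σ s, pA), by fun_prop⟩)
      (by
        intro s t x ht
        rw [if_pos (by linarith), hk2 _ _ (by linarith), hcA0]
        · rfl
        · exact mul_nonpos_of_nonneg_of_nonpos (by linarith [s.2.1]) (by linarith))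
      (by
        intro s t x ht
        rw [if_neg (by linarith), hk2 _ _ (by linarith), hcB0]
        · rfl
        · exact mul_nonpos_of_nonneg_of_nonpos (by linarith [s.2.1]) (by linarith))
    -- The common end of both homotopies stretches the middle half of the suspension.
    obtain ⟨Ψ, hΨ, hΨp⟩ := Suspension.exists_lift (Y := I) (L := L) (Z := Suspension L)
      (fun s t x => Suspension.point (s * (2 * t - 1 / 2) + (1 - s) * t) (DL (s, x)))
      (Suspension.continuous_point.comp (f := fun p : I × ℝ × L =>
        ((p.1 : ℝ) * (2 * p.2.1 - 1 / 2) + (1 - (p.1 : ℝ)) * p.2.1, DL (p.1, p.2.2)))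
        (by fun_prop))
      (fun i => ContinuousMap.const _ (Suspension.pole L i))
      (by
        intro s t x ht
        exact Suspension.point_of_nonpos (by nlinarith [s.2.1, s.2.2]) _)
      (by
        intro s t x ht
        exact Suspension.point_of_one_le (by nlinarith [s.2.1, s.2.2]) _)
    let m : C(Suspension L, Suspension L) := ⟨fun z => Ψ (1, z), by fun_prop⟩
    have h1 : (g.comp f).Homotopic m := by
      refine ⟨⟨Φ, fun z => ?_, fun z => ?_⟩⟩
      · change Φ (0, z) = g₀ ((), f₀ ((), z))
        rcases Suspension.exists_pole_or_point z with ⟨i, rfl⟩ | ⟨t, x, rfl⟩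
        · rw [hΦp, hfp]
          cases i
          · simp [hgA _ _ pA.2]
          · simp [hgB _ _ pB.2]
        · rw [hΦ]
          split_ifs with ht
          · rw [hfA _ _ ht, hgA _ _ (Subtype.property _), hk0]
            simp
          · rw [hfB _ _ (by linarith), hgB _ _ (Subtype.property _), hk0]
            simp
      · change Φ (1, z) = Ψ (1, z)
        rcases Suspension.exists_pole_or_point z with ⟨i, rfl⟩ | ⟨t, x, rfl⟩
        · rw [hΦp, hΨp]
          cases i
          · simp [hΓA0]
          · simp [hΓB0]
        · rw [hΦ, hΨ]
          split_ifs with ht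
          · rcases le_total (2 * t) (1 / 2) with ht' | ht'
            · rw [hk3 _ ht', hΓA0, Suspension.point_of_nonpos]
              simp
              linarith
            · rw [hcA1 _ _ (by simp; linarith), hΓAL, hk4 _ ht' (by linarith)]
              congr 1
              simp
              ring
          · rcases le_total (2 - 2 * t) (1 / 2) with ht' | ht'
            · rw [hk3 _ ht', hΓB0, Suspension.point_of_one_le]
              simp
              linarith
            · rw [hcB1 _ _ (by simp; linarith), hΓBL, hk4 _ ht' (by linarith)]
              congr 1
              simp
              ring
    have h2 : (ContinuousMap.id _).Homotopic m := by
      refine ⟨⟨Ψ, fun z => ?_, fun z => rfl⟩⟩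
      change Ψ (0, z) = z
      rcases Suspension.exists_pole_or_point z with ⟨i, rfl⟩ | ⟨t, x, rfl⟩
      · rw [hΨp]
        rfl
      · rw [hΨ, hDL0]
        simp
    exact h1.trans h2.symm
  exact ⟨⟨g, f, hfg.trans ⟨D.symm⟩, hgf⟩⟩

end Gluing

/-! ### Points of the realization of a finite complex -/

namespace PreAbstractSimplicialComplex

variable {α : Type*}

/-- The points of the full simplex on `V` in barycentric coordinates. -/
def simplexOn (V : Finset α) : Set (α → ℝ) :=
  {x | (∀ a, 0 ≤ x a) ∧ Function.support x ⊆ (V : Set α) ∧ ∑ a ∈ V, x a = 1}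

lemma mem_realization_iff {X : PreAbstractSimplicialComplex α} {V : Finset α}
    (hV : ∀ s ∈ X.faces, s ⊆ V) {x : α → ℝ} :
    x ∈ X.realization ↔ x ∈ simplexOn V ∧ ∃ s ∈ X.faces, Function.support x ⊆ (s : Set α) := by
  have key : ∀ s ⊆ V, Function.support x ⊆ (s : Set α) → ∑ a ∈ V, x a = ∑ a ∈ s, x a := by
    intro s hs hx
    refine (Finset.sum_subset hs fun a _ ha => ?_).symm
    by_contra h
    exact ha (hx h)
  constructor
  · rintro ⟨h0, s, hs, hx, hsum⟩
    exact ⟨⟨h0, hx.trans (Finset.coe_subset.mpr (hV s hs)), by rw [key s (hV s hs) hx, hsum]⟩,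
      s, hs, hx⟩
  · rintro ⟨⟨h0, -, hsum⟩, s, hs, hx⟩
    exact ⟨h0, s, hs, hx, by rw [← key s (hV s hs) hx, hsum]⟩

lemma combo_mem_simplexOn {V : Finset α} {x y : α → ℝ} (hx : x ∈ simplexOn V)
    (hy : y ∈ simplexOn V) (t : unitInterval) : (1 - (t : ℝ)) • x + (t : ℝ) • y ∈ simplexOn V := by
  have ht0 := t.2.1
  have ht1 : 0 ≤ 1 - (t : ℝ) := sub_nonneg.mpr t.2.2
  refine ⟨fun a => ?_, fun a ha => ?_, ?_⟩
  · have := hx.1 a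
    have := hy.1 a
    simp only [Pi.add_apply, Pi.smul_apply, smul_eq_mul]
    positivity
  · by_contra h
    have h1 : x a = 0 := by_contra fun h' => h (hx.2.1 h')
    have h2 : y a = 0 := by_contra fun h' => h (hy.2.1 h')
    exact ha (by simp [h1, h2])
  · simp only [Pi.add_apply, Pi.smul_apply, smul_eq_mul]
    rw [Finset.sum_add_distrib, ← Finset.mul_sum, ← Finset.mul_sum, hx.2.2, hy.2.2]
    ring

lemma support_combo_subset {x y : α → ℝ} {s : Set α} (hx : Function.support x ⊆ s)
    (hy : Function.support y ⊆ s) (t : ℝ) :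
    Function.support ((1 - t) • x + t • y) ⊆ s := by
  intro a ha
  by_contra h
  have h1 : x a = 0 := by_contra fun h' => h (hx h')
  have h2 : y a = 0 := by_contra fun h' => h (hy h')
  exact ha (by simp [h1, h2])

lemma homotopic_of_combo_mem {Y : Type*} [TopologicalSpace Y] {Z : Set (α → ℝ)} (f g : C(Y, Z))
    (h : ∀ y (t : unitInterval), (1 - (t : ℝ)) • (f y : α → ℝ) + (t : ℝ) • (g y : α → ℝ) ∈ Z) :
    f.Homotopic g := by
  refine ⟨⟨⟨fun p => ⟨_, h p.2 p.1⟩, ?_⟩, fun y => ?_, fun y => ?_⟩⟩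
  · exact Continuous.subtype_mk (by fun_prop) _
  · exact Subtype.ext (by simp)
  · exact Subtype.ext (by simp)

lemma single_mem_simplexOn [DecidableEq α] {V : Finset α} {v : α} (hv : v ∈ V) :
    Pi.single v (1 : ℝ) ∈ simplexOn V := by
  refine ⟨fun a => ?_, fun a ha => ?_, ?_⟩
  · rw [Pi.single_apply]
    split_ifs <;> norm_num
  · by_contra h
    refine ha (Pi.single_eq_of_ne ?_ _)
    rintro rfl
    exact h hv
  · rw [Finset.sum_eq_single_of_mem v hv fun a _ ha => Pi.single_eq_of_ne ha _, Pi.single_eq_same]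

lemma support_single_subset [DecidableEq α] (v : α) :
    Function.support (Pi.single v (1 : ℝ)) ⊆ {v} := Pi.support_single_subset

/-- A complex is contractible if `v` can be added to each of its faces. -/
lemma contractibleSpace_of_cone [DecidableEq α] (X : PreAbstractSimplicialComplex α)
    {V : Finset α} (hV : ∀ s ∈ X.faces, s ⊆ V) {v : α} (hv : {v} ∈ X.faces)
    (h : ∀ s ∈ X.faces, insert v s ∈ X.faces) : ContractibleSpace X.realization := by
  have hvV : Pi.single v (1 : ℝ) ∈ simplexOn V :=
    single_mem_simplexOn (hV _ hv (Finset.mem_singleton_self v))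
  rw [contractible_iff_id_nullhomotopic]
  refine ⟨⟨Pi.single v 1, (mem_realization_iff hV).mpr ⟨hvV, {v}, hv, ?_⟩⟩, ?_⟩
  · simp
  refine homotopic_of_combo_mem _ _ fun x t => ?_
  obtain ⟨hx, s, hs, hxs⟩ := (mem_realization_iff hV).mp x.2
  refine (mem_realization_iff hV).mpr ⟨combo_mem_simplexOn hx hvV t, _, h s hs, ?_⟩
  refine support_combo_subset (hxs.trans ?_) ((support_single_subset v).trans ?_) _ <;> simp

/-! ### Truncation of small coordinates -/

/-- A continuous measure of how far `x` is from the realization of `X`. For `X` with vertices in `V`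
and `x` in the simplex on `V`, it vanishes exactly on the realization; if it is less than `1`, then
the vertices where `x` is at least `c` form a face, unless there are none. -/
noncomputable def nonfaceWeight (X : PreAbstractSimplicialComplex α) (V : Finset α) (c : ℝ)
    (x : α → ℝ) : ℝ := by
  classical
  exact ∑ τ ∈ V.powerset with τ.Nonempty ∧ τ ∉ X.faces, ∏ a ∈ τ, min 1 (x a / c)

section nonfaceWeight

variable (X : PreAbstractSimplicialComplex α) {V : Finset α} {c : ℝ} {x : α → ℝ}

lemma continuous_nonfaceWeight : Continuous (nonfaceWeight X V c) := by
  unfold nonfaceWeight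
  fun_prop

lemma nonfaceWeight_nonneg (hc : 0 < c) (hx : ∀ a, 0 ≤ x a) : 0 ≤ nonfaceWeight X V c x := by
  unfold nonfaceWeight
  refine Finset.sum_nonneg fun τ _ => Finset.prod_nonneg fun a _ => ?_
  have := hx a
  positivity

lemma le_nonfaceWeight (hc : 0 < c) (hx : ∀ a, 0 ≤ x a) {τ : Finset α} (hτV : τ ⊆ V)
    (hτ : τ.Nonempty) (hτX : τ ∉ X.faces) :
    ∏ a ∈ τ, min 1 (x a / c) ≤ nonfaceWeight X V c x := by
  classical
  unfold nonfaceWeight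
  refine Finset.single_le_sum (f := fun τ => ∏ a ∈ τ, min 1 (x a / c))
    (fun τ _ => Finset.prod_nonneg fun a _ => ?_) (by simp [*])
  have := hx a
  positivity

lemma mem_realization_iff_nonfaceWeight (hV : ∀ s ∈ X.faces, s ⊆ V) (hc : 0 < c)
    (hx : x ∈ simplexOn V) : x ∈ X.realization ↔ nonfaceWeight X V c x = 0 := by
  classical
  constructor
  · rintro h
    obtain ⟨-, s, hs, hxs⟩ := (mem_realization_iff hV).mp h
    unfold nonfaceWeight
    refine Finset.sum_eq_zero fun τ hτ => ?_
    obtain ⟨-, hne, hτX⟩ := Finset.mem_filter.mp hτ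
    have : ¬ τ ⊆ s := fun h => hτX ((X.isRelLowerSet_faces hs).2 h hne)
    obtain ⟨a, haτ, has⟩ := Finset.not_subset.mp this
    have hxa : x a = 0 := by_contra fun h => has (hxs h)
    exact Finset.prod_eq_zero haτ (by simp [hxa])
  · intro h
    refine (mem_realization_iff hV).mpr ⟨hx, V.filter (fun a => x a ≠ 0), ?_, fun a ha => ?_⟩
    · by_contra hs
      have hne : (V.filter (fun a => x a ≠ 0)).Nonempty := by
        by_contra hne
        have h0 : ∑ a ∈ V, x a = 0 := Finset.sum_eq_zero fun a ha => by
          by_contra hxa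
          exact hne ⟨a, Finset.mem_filter.mpr ⟨ha, hxa⟩⟩
        rw [hx.2.2] at h0
        exact one_ne_zero h0
      have hle := le_nonfaceWeight X hc hx.1 (Finset.filter_subset _ _) hne hs
      refine absurd (h ▸ hle) (not_le.mpr (Finset.prod_pos fun a ha => ?_))
      have : 0 < x a := (hx.1 a).lt_of_ne' (Finset.mem_filter.mp ha).2
      positivity
    · exact Finset.mem_coe.mpr (Finset.mem_filter.mpr ⟨hx.2.1 ha, ha⟩)

lemma mem_faces_of_nonfaceWeight_lt_one (hc : 0 < c) (hx : ∀ a, 0 ≤ x a)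
    (h : nonfaceWeight X V c x < 1) {τ : Finset α} (hτV : τ ⊆ V) (hτ : τ.Nonempty)
    (hτc : ∀ a ∈ τ, c ≤ x a) : τ ∈ X.faces := by
  by_contra hτX
  have hle := le_nonfaceWeight X hc hx hτV hτ hτX
  rw [Finset.prod_eq_one] at hle
  · linarith
  · intro a ha
    rw [min_eq_left ((one_le_div hc).mpr (hτc a ha))]

end nonfaceWeight

/-- The truncation level for `V`. As it is less than `1 / #V`, every point of the simplex on `V`
has a coordinate above it. -/
noncomputable def level (V : Finset α) : ℝ := 1 / (V.card + 1)

lemma level_pos (V : Finset α) : 0 < level V := by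
  unfold level
  positivity

/-- Subtracts the truncation level from all coordinates, replaces negative results by `0`, and
normalizes. -/
noncomputable def truncate (V : Finset α) (x : α → ℝ) : α → ℝ :=
  fun a => max 0 (x a - level V) / ∑ b ∈ V, max 0 (x b - level V)

lemma sum_truncate_pos {V : Finset α} {x : α → ℝ} (hx : x ∈ simplexOn V) :
    0 < ∑ b ∈ V, max 0 (x b - level V) := by
  have h1 : ∑ b ∈ V, (x b - level V) ≤ ∑ b ∈ V, max 0 (x b - level V) :=
    Finset.sum_le_sum fun b _ => le_max_right _ _
  have h2 : ∑ b ∈ V, (x b - level V) = level V := by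
    rw [Finset.sum_sub_distrib, hx.2.2, Finset.sum_const, nsmul_eq_mul, level]
    field_simp
    ring
  linarith [level_pos V]

lemma level_lt_of_mem_support_truncate {V : Finset α} {x : α → ℝ} {a : α}
    (ha : a ∈ Function.support (truncate V x)) : level V < x a := by
  by_contra h
  refine ha ?_
  rw [truncate, max_eq_left (by linarith), zero_div]

lemma support_truncate_subset {V : Finset α} {x : α → ℝ} :
    Function.support (truncate V x) ⊆ Function.support x := fun _ ha =>
  ((level_pos V).trans (level_lt_of_mem_support_truncate ha)).ne'

lemma truncate_mem_simplexOn {V : Finset α} {x : α → ℝ} (hx : x ∈ simplexOn V) :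
    truncate V x ∈ simplexOn V := by
  have hpos := sum_truncate_pos hx
  refine ⟨fun a => ?_, support_truncate_subset.trans hx.2.1, ?_⟩
  · unfold truncate
    positivity
  · unfold truncate
    rw [← Finset.sum_div, div_self hpos.ne']

lemma exists_mem_support_of_mem_simplexOn {V : Finset α} {x : α → ℝ} (hx : x ∈ simplexOn V) :
    ∃ a ∈ V, a ∈ Function.support x := by
  by_contra h
  push Not at h
  have h0 : ∑ a ∈ V, x a = 0 := Finset.sum_eq_zero fun a ha => by simpa using h a ha
  rw [hx.2.2] at h0
  exact one_ne_zero h0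

/-- The coordinates of `x` that are at least the truncation level. -/
noncomputable def largeVertices (V : Finset α) (x : α → ℝ) : Finset α := by
  classical
  exact V.filter fun a => level V ≤ x a

lemma support_truncate_subset_largeVertices {V : Finset α} {x : α → ℝ} (hx : x ∈ simplexOn V) :
    Function.support (truncate V x) ⊆ largeVertices V x := by
  intro a ha
  simp only [largeVertices, Finset.coe_filter, Set.mem_ofPred_eq]
  exact ⟨(truncate_mem_simplexOn hx).2.1 ha, (level_lt_of_mem_support_truncate ha).le⟩

lemma largeVertices_mem_faces (X : PreAbstractSimplicialComplex α) {V : Finset α} {x : α → ℝ}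
    (hx : x ∈ simplexOn V) (h : nonfaceWeight X V (level V) x < 1) :
    largeVertices V x ∈ X.faces := by
  classical
  obtain ⟨a, -, ha⟩ := exists_mem_support_of_mem_simplexOn (truncate_mem_simplexOn hx)
  refine mem_faces_of_nonfaceWeight_lt_one X (level_pos V) hx.1 h ?_
    ⟨a, support_truncate_subset_largeVertices hx ha⟩ ?_
  · exact Finset.filter_subset _ _
  · intro b hb
    simp only [largeVertices, Finset.mem_filter] at hb
    exact hb.2

lemma continuousOn_truncate (V : Finset α) : ContinuousOn (truncate V) (simplexOn V) := by
  unfold truncate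
  refine continuousOn_pi.mpr fun a => ContinuousOn.div (by fun_prop) (by fun_prop) fun x hx => ?_
  exact (sum_truncate_pos hx).ne'

lemma mem_realization_of_support_subset {X : PreAbstractSimplicialComplex α} {V : Finset α}
    (hV : ∀ s ∈ X.faces, s ⊆ V) {x y : α → ℝ} (hx : x ∈ X.realization) (hy : y ∈ simplexOn V)
    (hyx : Function.support y ⊆ Function.support x) : y ∈ X.realization := by
  obtain ⟨-, s, hs, hxs⟩ := (mem_realization_iff hV).mp hx
  exact (mem_realization_iff hV).mpr ⟨hy, s, hs, hyx.trans hxs⟩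

/-- Truncation as a self-map of the realization. -/
lemma exists_truncateMap {X : PreAbstractSimplicialComplex α} {V : Finset α}
    (hV : ∀ s ∈ X.faces, s ⊆ V) :
    ∃ T : C(X.realization, X.realization), ∀ x, (T x : α → ℝ) = truncate V x := by
  have hsub : X.realization ⊆ simplexOn V := fun x hx => ((mem_realization_iff hV).mp hx).1
  refine ⟨⟨fun x => ⟨truncate V x, mem_realization_of_support_subset hV x.2
    (truncate_mem_simplexOn (hsub x.2)) support_truncate_subset⟩, ?_⟩, fun x => rfl⟩
  exact Continuous.subtype_mk
    (continuousOn_iff_continuous_domRestrict.mp ((continuousOn_truncate V).mono hsub)) _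

/-! ### The union of two contractible complexes -/

/-- The geometric form of the gluing theorem: a finite complex that is the union of two
contractible subcomplexes is the suspension of their intersection up to homotopy. -/
theorem nonempty_homotopyEquiv_suspension_inf {X A B : PreAbstractSimplicialComplex α}
    {V : Finset α} (hV : ∀ s ∈ X.faces, s ⊆ V) (hX : X = A ⊔ B)
    [ContractibleSpace A.realization] [ContractibleSpace B.realization] :
    Nonempty (ContinuousMap.HomotopyEquiv X.realization (Suspension (A ⊓ B).realization)) := by
  have hmem : ∀ s, s ∈ X.faces ↔ s ∈ A.faces ∨ s ∈ B.faces := fun s => by rw [hX]; rfl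
  have hVA : ∀ s ∈ A.faces, s ⊆ V := fun s hs => hV s ((hmem s).mpr (Or.inl hs))
  have hVB : ∀ s ∈ B.faces, s ⊆ V := fun s hs => hV s ((hmem s).mpr (Or.inr hs))
  have hVL : ∀ s ∈ (A ⊓ B).faces, s ⊆ V := fun s hs => hVA s hs.1
  have hAX : A.realization ⊆ X.realization := fun x hx => by
    obtain ⟨hx, s, hs, hxs⟩ := (mem_realization_iff hVA).mp hx
    exact (mem_realization_iff hV).mpr ⟨hx, s, (hmem s).mpr (Or.inl hs), hxs⟩
  have hBX : B.realization ⊆ X.realization := fun x hx => by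
    obtain ⟨hx, s, hs, hxs⟩ := (mem_realization_iff hVB).mp hx
    exact (mem_realization_iff hV).mpr ⟨hx, s, (hmem s).mpr (Or.inr hs), hxs⟩
  have hL : (A ⊓ B).realization = A.realization ∩ B.realization := by
    ext x
    constructor
    · intro hx
      obtain ⟨hx, s, hs, hxs⟩ := (mem_realization_iff hVL).mp hx
      exact ⟨(mem_realization_iff hVA).mpr ⟨hx, s, hs.1, hxs⟩,
        (mem_realization_iff hVB).mpr ⟨hx, s, hs.2, hxs⟩⟩
    · rintro ⟨hxA, hxB⟩
      obtain ⟨hx, s, hs, hxs⟩ := (mem_realization_iff hVA).mp hxA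
      obtain ⟨-, t, ht, hxt⟩ := (mem_realization_iff hVB).mp hxB
      obtain ⟨a, -, ha⟩ := exists_mem_support_of_mem_simplexOn hx
      classical
      have hne : (s ∩ t).Nonempty := ⟨a, Finset.mem_inter.mpr ⟨hxs ha, hxt ha⟩⟩
      refine (mem_realization_iff hVL).mpr ⟨hx, s ∩ t, ⟨?_, ?_⟩, ?_⟩
      · exact (A.isRelLowerSet_faces hs).2 Finset.inter_subset_left hne
      · exact (B.isRelLowerSet_faces ht).2 Finset.inter_subset_right hne
      · rw [Finset.coe_inter]
        exact Set.subset_inter hxs hxt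
  have hXS : ∀ x : X.realization, (x : α → ℝ) ∈ simplexOn V :=
    fun x => ((mem_realization_iff hV).mp x.2).1
  have transfer : ∀ Z : Set (α → ℝ), Z ⊆ X.realization → ContractibleSpace Z →
      ContractibleSpace {x : X.realization | (x : α → ℝ) ∈ Z} := by
    intro Z hZ _
    let e : {x : X.realization | (x : α → ℝ) ∈ Z} ≃ₜ Z :=
      { toFun := fun x => ⟨x.1.1, x.2⟩
        invFun := fun z => ⟨⟨z.1, hZ z.2⟩, z.2⟩
        left_inv := fun x => rfl
        right_inv := fun z => rfl
        continuous_toFun := by fun_prop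
        continuous_invFun := by fun_prop }
    exact e.contractibleSpace
  have := transfer _ hAX inferInstance
  have := transfer _ hBX inferInstance
  obtain ⟨T, hT⟩ := exists_truncateMap hV
  have hcombo : ∀ (x : X.realization) (t : unitInterval),
      (1 - (t : ℝ)) • (x : α → ℝ) + (t : ℝ) • (T x : α → ℝ) ∈ simplexOn V := fun x t =>
    combo_mem_simplexOn (hXS x) (hXS _) t
  have hsupp : ∀ (x : X.realization) (t : unitInterval),
      Function.support ((1 - (t : ℝ)) • (x : α → ℝ) + (t : ℝ) • (T x : α → ℝ)) ⊆
        Function.support (x : α → ℝ) := fun x t =>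
    support_combo_subset subset_rfl (hT x ▸ support_truncate_subset) _
  let D : (ContinuousMap.id X.realization).Homotopy T :=
    { toFun := fun p => ⟨(1 - (p.1 : ℝ)) • (p.2 : α → ℝ) + (p.1 : ℝ) • (T p.2 : α → ℝ),
        mem_realization_of_support_subset hV p.2.2 (hcombo _ _) (hsupp _ _)⟩
      continuous_toFun := Continuous.subtype_mk (by fun_prop) _
      map_zero_left := fun x => Subtype.ext (by simp)
      map_one_left := fun x => Subtype.ext (by simp) }
  have hw : ∀ Z : PreAbstractSimplicialComplex α, Continuous fun x : X.realization =>
      nonfaceWeight Z V (level V) x := fun Z =>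
    (continuous_nonfaceWeight Z).comp continuous_subtype_val
  have hpush : ∀ Z : PreAbstractSimplicialComplex α, (∀ s ∈ Z.faces, s ⊆ V) →
      ∀ x : X.realization, nonfaceWeight Z V (level V) x < 1 → (T x : α → ℝ) ∈ Z.realization := by
    intro Z hZ x hx
    rw [hT]
    exact (mem_realization_iff hZ).mpr ⟨truncate_mem_simplexOn (hXS x), _,
      largeVertices_mem_faces Z (hXS x) hx, support_truncate_subset_largeVertices (hXS x)⟩
  refine nonempty_homotopyEquiv_suspension {x : X.realization | (x : α → ℝ) ∈ A.realization}
    {x : X.realization | (x : α → ℝ) ∈ B.realization} (fun x => ?_)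
    (fun x : (A ⊓ B).realization => ⟨x, hAX (hL.subset x.2).1⟩) ?_ ?_
    ⟨_, hw A⟩ ⟨_, hw B⟩
    (fun x => nonfaceWeight_nonneg A (level_pos V) (hXS x).1)
    (fun x => nonfaceWeight_nonneg B (level_pos V) (hXS x).1)
    (fun x => mem_realization_iff_nonfaceWeight A hVA (level_pos V) (hXS x))
    (fun x => mem_realization_iff_nonfaceWeight B hVB (level_pos V) (hXS x))
    T D (fun s x hx => ?_) (fun s x hx => ?_) (hpush A hVA) (hpush B hVB)
  · obtain ⟨hx, s, hs, hxs⟩ := (mem_realization_iff hV).mp x.2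
    exact ((hmem s).mp hs).imp (fun h => (mem_realization_iff hVA).mpr ⟨hx, s, h, hxs⟩)
      (fun h => (mem_realization_iff hVB).mpr ⟨hx, s, h, hxs⟩)
  · exact IsEmbedding.of_comp (by fun_prop) continuous_subtype_val IsEmbedding.subtypeVal
  · ext x
    constructor
    · rintro ⟨y, rfl⟩
      exact hL.subset y.2
    · intro hx
      exact ⟨⟨x, hL.superset hx⟩, rfl⟩
  · exact mem_realization_of_support_subset hVA hx (hcombo _ _) (hsupp _ _)
  · exact mem_realization_of_support_subset hVB hx (hcombo _ _) (hsupp _ _)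

/-! ### Unions of closed stars -/

lemma mem_faces_closedStar [DecidableEq α] {X : PreAbstractSimplicialComplex α}
    {σ τ : Finset α} : τ ∈ (X.closedStar σ).faces ↔ τ.Nonempty ∧ τ ∪ σ ∈ X.faces := by
  refine and_congr_right fun _ => ⟨?_, fun h => ⟨_, h, Finset.coe_union _ _⟩⟩
  rintro ⟨ρ, hρ, h⟩
  rw [← Finset.coe_union, Finset.coe_inj] at h
  exact h ▸ hρ

lemma mem_faces_iSup {κ : Sort*} {X : κ → PreAbstractSimplicialComplex α} {s : Finset α} :
    s ∈ (⨆ i, X i).faces ↔ ∃ i, s ∈ (X i).faces := by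
  change s ∈ ⋃ K ∈ Set.range X, K.faces ↔ _
  simp

/-- A union of closed stars of simplices `σ i` is contractible if a simplex that spans a face with
some of the `σ i` individually also spans a face with all of these together. -/
theorem contractibleSpace_iSup_closedStar [DecidableEq α] {κ : Type*} [Fintype κ] [Nonempty κ]
    {X : PreAbstractSimplicialComplex α} {V : Finset α} (hV : ∀ s ∈ X.faces, s ⊆ V)
    (σ : κ → Finset α) (hσ : ∀ i, σ i ∈ X.faces)
    (h : ∀ (τ : Finset α) (S : Finset κ), S.Nonempty → (∀ i ∈ S, τ ∪ σ i ∈ X.faces) →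
      τ ∪ S.biUnion σ ∈ X.faces) :
    ContractibleSpace (⨆ i, X.closedStar (σ i)).realization := by
  set B := ⨆ i, X.closedStar (σ i : Set α) with hBdef
  have hB : ∀ s, s ∈ B.faces ↔ ∃ i, s.Nonempty ∧ s ∪ σ i ∈ X.faces := fun s => by
    simp_rw [hBdef, mem_faces_iSup, mem_faces_closedStar]
  have hVB : ∀ s ∈ B.faces, s ⊆ V := fun s hs => by
    obtain ⟨i, -, hs⟩ := (hB s).mp hs
    exact Finset.subset_union_left.trans (hV _ hs)
  have hσne : ∀ i, (σ i).Nonempty := fun i => (X.isRelLowerSet_faces (hσ i)).1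
  choose u hu using hσne
  have huV : ∀ i, u i ∈ V := fun i => hV _ (hσ i) (hu i)
  -- A face that contains some `σ i` lies in the union of the stars.
  have hBi : ∀ (S : Finset κ) (τ : Finset α), S.Nonempty → (∀ i ∈ S, τ ∪ σ i ∈ X.faces) →
      τ ∪ S.biUnion σ ∈ B.faces := by
    intro S τ hS hτ
    obtain ⟨i, hi⟩ := hS
    refine (hB _).mpr ⟨i, ⟨u i, ?_⟩, ?_⟩
    · exact Finset.mem_union_right _ (Finset.mem_biUnion.mpr ⟨i, hi, hu i⟩)
    · rw [Finset.union_assoc, Finset.union_eq_left.mpr (Finset.subset_biUnion_of_mem σ hi)]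
      exact h τ S ⟨i, hi⟩ hτ
  let w : κ → (α → ℝ) → ℝ := fun i x =>
    max 0 (1 - nonfaceWeight (X.closedStar (σ i : Set α)) V (level V) x)
  have hw0 : ∀ i x, 0 ≤ w i x := fun i x => le_max_left _ _
  have hwc : ∀ i, Continuous (w i) := fun i => by
    have := continuous_nonfaceWeight (V := V) (c := level V) (X.closedStar (σ i : Set α))
    fun_prop
  have hBS : ∀ x ∈ B.realization, x ∈ simplexOn V :=
    fun x hx => ((mem_realization_iff hVB).mp hx).1
  have hwpos : ∀ x ∈ B.realization, 0 < ∑ i, w i x := by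
    intro x hx
    obtain ⟨hxV, s, hs, hxs⟩ := (mem_realization_iff hVB).mp hx
    obtain ⟨i, hs⟩ := (hB s).mp hs
    have hVi : ∀ s ∈ (X.closedStar (σ i : Set α)).faces, s ⊆ V := fun s hs =>
      Finset.subset_union_left.trans (hV _ (mem_faces_closedStar.mp hs).2)
    have hxi : x ∈ (X.closedStar (σ i : Set α)).realization :=
      (mem_realization_iff hVi).mpr ⟨hxV, s, mem_faces_closedStar.mpr hs, hxs⟩
    have hwi : w i x = 1 := by
      simp [w, (mem_realization_iff_nonfaceWeight _ hVi (level_pos V) hxV).mp hxi]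
    exact Finset.sum_pos' (fun j _ => hw0 j x) ⟨i, Finset.mem_univ i, by rw [hwi]; exact one_pos⟩
  have hface : ∀ x ∈ B.realization, ∀ i, 0 < w i x → largeVertices V x ∪ σ i ∈ X.faces := by
    intro x hx i hi
    have hlt : nonfaceWeight (X.closedStar (σ i : Set α)) V (level V) x < 1 := by
      by_contra hge
      exact hi.ne' (max_eq_left (by linarith))
    exact (mem_faces_closedStar.mp (largeVertices_mem_faces _ (hBS x hx) hlt)).2
  let φ : (α → ℝ) → α → ℝ := fun x => ∑ i, (w i x / ∑ j, w j x) • Pi.single (u i) (1 : ℝ)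
  have hφsupp : ∀ x ∈ B.realization, ∃ S : Finset κ, S.Nonempty ∧ (∀ i ∈ S, 0 < w i x) ∧
      Function.support (φ x) ⊆ (S.biUnion σ : Finset α) := by
    intro x hx
    refine ⟨Finset.univ.filter fun i => 0 < w i x, ?_, by simp, fun a ha => ?_⟩
    · by_contra hne
      refine (hwpos x hx).ne' (Finset.sum_eq_zero fun i _ => ?_)
      by_contra hi
      exact hne ⟨i, by simpa using (hw0 i x).lt_of_ne' hi⟩
    · by_contra hS
      refine ha ?_
      simp only [φ, Finset.sum_apply, Pi.smul_apply, smul_eq_mul]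
      refine Finset.sum_eq_zero fun i _ => ?_
      rcases (hw0 i x).eq_or_lt with hi | hi
      · simp [← hi]
      · rw [Pi.single_eq_of_ne, mul_zero]
        rintro rfl
        exact hS (Finset.mem_coe.mpr (Finset.mem_biUnion.mpr ⟨i, by simpa using hi, hu i⟩))
  have hφV : ∀ x ∈ B.realization, φ x ∈ simplexOn V := by
    intro x hx
    have hpos := hwpos x hx
    refine ⟨fun a => ?_, ?_, ?_⟩
    · simp only [φ, Finset.sum_apply, Pi.smul_apply, smul_eq_mul]
      exact Finset.sum_nonneg fun i _ => mul_nonneg (div_nonneg (hw0 i x) hpos.le)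
        ((single_mem_simplexOn (huV i)).1 a)
    · obtain ⟨S, -, -, hS⟩ := hφsupp x hx
      refine hS.trans (Finset.coe_subset.mpr (Finset.biUnion_subset.mpr fun i _ => ?_))
      exact hV _ (hσ i)
    · simp only [φ, Finset.sum_apply, Pi.smul_apply, smul_eq_mul]
      rw [Finset.sum_comm]
      simp_rw [← Finset.mul_sum, fun i => (single_mem_simplexOn (huV i)).2.2, mul_one]
      rw [← Finset.sum_div, div_self hpos.ne']
  have hφmid : ∀ x ∈ B.realization, ∃ s ∈ B.faces, Function.support (φ x) ⊆ (s : Set α) ∧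
      Function.support (truncate V x) ⊆ (s : Set α) := by
    intro x hx
    obtain ⟨S, hSne, hSw, hS⟩ := hφsupp x hx
    refine ⟨_, hBi S _ hSne fun i hi => hface x hx i (hSw i hi), ?_, ?_⟩
    · exact hS.trans (Finset.coe_subset.mpr Finset.subset_union_right)
    · exact (support_truncate_subset_largeVertices (hBS x hx)).trans
        (Finset.coe_subset.mpr Finset.subset_union_left)
  have hall : Finset.univ.biUnion σ ∈ B.faces := by
    simpa using hBi Finset.univ ∅ Finset.univ_nonempty fun i _ => by simpa using hσ i
  obtain ⟨T, hT⟩ := exists_truncateMap hVB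
  let Φ : C(B.realization, B.realization) :=
    ⟨fun x => ⟨φ x, by
      obtain ⟨s, hs, hxs, -⟩ := hφmid x x.2
      exact (mem_realization_iff hVB).mpr ⟨hφV x x.2, s, hs, hxs⟩⟩, by
      refine Continuous.subtype_mk ?_ _
      have hwB : ∀ i, Continuous fun x : B.realization => w i x := fun i =>
        (hwc i).comp continuous_subtype_val
      refine continuous_finsetSum _ fun i _ => ?_
      have : Continuous fun x : B.realization => w i x / ∑ j, w j x :=
        (hwB i).div (continuous_finsetSum _ fun j _ => hwB j) fun x => (hwpos x x.2).ne'
      fun_prop⟩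
  obtain ⟨i₀⟩ := ‹Nonempty κ›
  have hpS : Pi.single (u i₀) (1 : ℝ) ∈ simplexOn V := single_mem_simplexOn (huV i₀)
  have hpsupp : Function.support (Pi.single (u i₀) (1 : ℝ)) ⊆
      (Finset.univ.biUnion σ : Finset α) := by
    refine (support_single_subset _).trans (Set.singleton_subset_iff.mpr ?_)
    exact Finset.mem_coe.mpr (Finset.mem_biUnion.mpr ⟨i₀, Finset.mem_univ _, hu i₀⟩)
  let p : B.realization := ⟨Pi.single (u i₀) 1,
    (mem_realization_iff hVB).mpr ⟨hpS, _, hall, hpsupp⟩⟩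
  rw [contractible_iff_id_nullhomotopic]
  refine ⟨p, ?_⟩
  have h1 : (ContinuousMap.id B.realization).Homotopic T := by
    refine homotopic_of_combo_mem _ _ fun x t => ?_
    rw [hT]
    exact mem_realization_of_support_subset hVB x.2
      (combo_mem_simplexOn (hBS x x.2) (truncate_mem_simplexOn (hBS x x.2)) t)
      (support_combo_subset subset_rfl support_truncate_subset _)
  have h2 : T.Homotopic Φ := by
    refine homotopic_of_combo_mem _ _ fun x t => ?_
    obtain ⟨s, hs, hφs, hTs⟩ := hφmid x x.2
    rw [hT]
    exact (mem_realization_iff hVB).mpr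
      ⟨combo_mem_simplexOn (truncate_mem_simplexOn (hBS x x.2)) (hφV x x.2) t, s, hs,
        support_combo_subset hTs hφs _⟩
  have h3 : Φ.Homotopic (ContinuousMap.const _ p) := by
    refine homotopic_of_combo_mem _ _ fun x t => ?_
    obtain ⟨S, -, -, hS⟩ := hφsupp x x.2
    refine (mem_realization_iff hVB).mpr
      ⟨combo_mem_simplexOn (hφV x x.2) hpS t, _, hall, support_combo_subset (hS.trans ?_) hpsupp _⟩
    exact Finset.coe_subset.mpr
      (Finset.biUnion_subset_biUnion_of_subset_left σ (Finset.subset_univ S))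
  exact h1.trans (h2.trans h3)

end PreAbstractSimplicialComplex

/-! ### Independence complexes of hypergraphs -/

namespace Hypergraph

variable {α : Type*} {H : Hypergraph α} {v : α}

/-- Two edges `e`, `e'` through `v` and an edge `f` that avoids `v`, together with points of `f` in
`e \ e'` and in `e' \ e`, form an induced Berge cycle of length `3`. -/
lemma exists_isInducedBergeCycle_three {e e' f : Set α} (he : e ∈ H.edgeSet)
    (he' : e' ∈ H.edgeSet) (hf : f ∈ H.edgeSet) (hve : v ∈ e) (hve' : v ∈ e') (hvf : v ∉ f)
    {x y : α} (hxe : x ∈ e) (hxe' : x ∉ e') (hye : y ∉ e) (hye' : y ∈ e') (hxf : x ∈ f)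
    (hyf : y ∈ f) :
    ∃ (u : Fin 3 → α) (g : Fin 3 → Set α), H.IsInducedBergeCycle 3 u g ∧ v ∈ Set.range u := by
  have hvx : v ≠ x := by rintro rfl; exact hvf hxf
  have hvy : v ≠ y := by rintro rfl; exact hvf hyf
  have hxy : x ≠ y := by rintro rfl; exact hye hxe
  have hef : e ≠ f := by rintro rfl; exact hvf hve
  have hef' : e' ≠ f := by rintro rfl; exact hvf hve'
  have hee' : e ≠ e' := by rintro rfl; exact hxe' hxe
  refine ⟨![v, x, y], ![e, f, e'], ⟨⟨?_, ?_, ?_, ?_, ?_⟩, ?_, ?_⟩, ⟨0, rfl⟩⟩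
  · intro i j hij
    fin_cases i <;> fin_cases j <;> simp_all
  · intro i j hij
    fin_cases i <;> fin_cases j <;> simp_all
  · intro i
    fin_cases i <;> simp [*]
  · intro i
    fin_cases i <;> simp [*]
  · intro i
    fin_cases i <;> simp [*]
  · intro i
    ext z
    simp only [Set.mem_inter_iff, Set.mem_range, Fin.exists_fin_succ, Set.mem_insert_iff,
      Set.mem_singleton_iff]
    fin_cases i <;> simp <;> grind
  · intro i j h1 h2 h3
    fin_cases i <;> fin_cases j <;> simp at h1 h2 h3

open Classical in
/-- Stars of the sets `e \ {v}` behave as in a flag complex: if `τ` is independent together with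
each of several `e \ {v}`, it is independent together with all of them. Otherwise some edge `f` lies
in the union, and it avoids `v`. If `e` maximizes `f ∩ (τ ∪ e)`, then `f` has a point outside of
`τ ∪ e`, which lies in some `e'`, and by maximality a point in `e` outside of `τ ∪ e'`, so that `e`,
`f`, `e'` form an induced Berge cycle. -/
lemma union_biUnion_mem_faces_independenceComplex
    (hcyc : ¬ ∃ (u : Fin 3 → α) (f : Fin 3 → Set α),
      H.IsInducedBergeCycle 3 u f ∧ v ∈ Set.range u)
    {κ : Type*} (e : κ → Set α) (he : ∀ i, e i ∈ H.edgeSet) (hve : ∀ i, v ∈ e i)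
    (σ : κ → Finset α) (hσ : ∀ i, (σ i : Set α) = e i \ {v}) (τ : Finset α) (S : Finset κ)
    (hS : S.Nonempty) (h : ∀ i ∈ S, τ ∪ σ i ∈ H.independenceComplex.faces) :
    τ ∪ S.biUnion σ ∈ H.independenceComplex.faces := by
  have hσ' : ∀ i a, a ∈ σ i ↔ a ∈ e i ∧ a ≠ v := fun i a => by
    rw [← Finset.mem_coe, hσ]
    simp
  obtain ⟨i₀, hi₀⟩ := hS
  have hvτ : v ∉ τ := by
    intro hv
    refine (h i₀ hi₀).2.2 (e i₀) (he i₀) fun a ha => ?_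
    by_cases hav : a = v
    · subst hav
      simp [hv]
    · simp [hσ', ha, hav]
  refine ⟨?_, ?_, fun f hf hfsub => ?_⟩
  · exact (h i₀ hi₀).1.mono
      (Finset.union_subset_union_right (Finset.subset_biUnion_of_mem σ hi₀))
  · intro a ha
    simp only [Finset.coe_union, Finset.coe_biUnion, Set.mem_union, Finset.mem_coe,
      Set.mem_iUnion] at ha
    rcases ha with ha | ⟨i, hi, ha⟩
    · exact (h i₀ hi₀).2.1 (by simp [ha])
    · exact (h i hi).2.1 (by simp [ha])
  have hmem : ∀ a ∈ f, a ∈ τ ∨ ∃ i ∈ S, a ∈ e i ∧ a ≠ v := fun a ha => by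
    simpa [hσ', and_left_comm] using hfsub ha
  have hvf : v ∉ f := fun hv => by
    rcases hmem v hv with hv | ⟨i, -, -, hv⟩
    · exact hvτ hv
    · exact hv rfl
  obtain ⟨i, hi, hmax⟩ := Finset.exists_max_image S
    (fun i => ((τ ∪ σ i).filter (· ∈ f)).card) ⟨i₀, hi₀⟩
  obtain ⟨y, hyf, hy⟩ := Set.not_subset.mp ((h i hi).2.2 f hf)
  simp only [Finset.coe_union, Set.mem_union, Finset.mem_coe, not_or] at hy
  obtain ⟨j, hj, hyj⟩ := (hmem y hyf).resolve_left hy.1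
  have hns : ¬ (τ ∪ σ i).filter (· ∈ f) ⊆ (τ ∪ σ j).filter (· ∈ f) := fun hsub => by
    have hlt := Finset.card_lt_card (Finset.ssubset_iff_subset_ne.mpr ⟨hsub, fun heq => by
      have : y ∈ (τ ∪ σ j).filter (· ∈ f) := by simp [hσ', hyj, hyf]
      rw [← heq] at this
      simp [hy] at this⟩)
    exact absurd (hmax j hj) (not_le.mpr hlt)
  obtain ⟨x, hx, hxj⟩ := Finset.not_subset.mp hns
  simp only [Finset.mem_filter, Finset.mem_union, hσ'] at hx hxj hy
  refine hcyc (exists_isInducedBergeCycle_three (he i) (he j) hf (hve i) (hve j) hvf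
    (x := x) (y := y) ?_ ?_ ?_ hyj.1 hx.2 hyf) <;> tauto

end Hypergraph

open PreAbstractSimplicialComplex in
theorem theorem1p1 {α : Type*} (H : Hypergraph α)
    (hfin : H.vertexSet.Finite)
    (hmin : IsAntichain (· ⊆ ·) H.edgeSet)
    (hcard : ∀ e ∈ H.edgeSet, 2 ≤ e.ncard)
    (v : α) (hv : v ∈ H.vertexSet)
    (hiso : ¬ H.IsIsolated v)
    (hcyc : ¬ ∃ (u : Fin 3 → α) (f : Fin 3 → Set α),
      H.IsInducedBergeCycle 3 u f ∧ v ∈ Set.range u) :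
    Nonempty (ContinuousMap.HomotopyEquiv
      H.independenceComplex.realization
      (Suspension
        (H.independenceComplex.closedStar {v} ⊓
          ⨆ e ∈ {e | e ∈ H.edgeSet ∧ v ∈ e},
            H.independenceComplex.closedStar (e \ {v})).realization)) := by
  classical
  set X := H.independenceComplex with hX
  let V : Finset α := hfin.toFinset
  have hV : ∀ s ∈ X.faces, s ⊆ V := fun s hs a ha => hfin.mem_toFinset.mpr (hs.2.1 ha)
  let κ := {e : Set α // e ∈ H.edgeSet ∧ v ∈ e}
  have : Finite κ := (hfin.powerset.subset fun e he =>
    H.subset_vertexSet_of_mem_edgeSet he.1 : {e : Set α | e ∈ H.edgeSet ∧ v ∈ e}.Finite).to_subtype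
  have := Fintype.ofFinite κ
  have : Nonempty κ := by
    simp only [Hypergraph.IsIsolated, not_forall, not_not] at hiso
    obtain ⟨e, he, hve⟩ := hiso
    exact ⟨⟨e, he, hve⟩⟩
  let σ : κ → Finset α := fun e => V.filter fun a => a ∈ e.1 \ {v}
  have hσ : ∀ e : κ, (σ e : Set α) = e.1 \ {v} := fun e => by
    ext a
    simp only [σ, Finset.coe_filter, Set.mem_ofPred_eq, and_iff_right_iff_imp]
    exact fun ha => hfin.mem_toFinset.mpr (H.subset_vertexSet_of_mem_edgeSet e.2.1 ha.1)
  have hsup : (⨆ e ∈ {e | e ∈ H.edgeSet ∧ v ∈ e}, X.closedStar (e \ {v})) =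
      ⨆ i, X.closedStar (σ i : Set α) := by
    simp_rw [hσ]
    exact iSup_subtype'
  rw [hsup]
  -- `e \ {v}` is independent, as no edge is properly contained in `e`.
  have hσX : ∀ i, σ i ∈ X.faces := by
    intro i
    refine ⟨?_, fun a ha => ?_, fun f hf hfsub => ?_⟩
    · obtain ⟨a, ha, hav⟩ := Set.exists_ne_of_one_lt_ncard (hcard i.1 i.2.1) v
      exact ⟨a, Finset.mem_coe.mp (by rw [hσ]; exact ⟨ha, hav⟩)⟩
    · exact hfin.mem_toFinset.mp (Finset.filter_subset _ _ ha)
    · rw [hσ] at hfsub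
      have hfi : f = i.1 := hmin.eq hf i.2.1 (hfsub.trans Set.sdiff_subset)
      exact (hfsub (hfi ▸ i.2.2)).2 rfl
  have hvX : {v} ∈ X.faces := by
    refine ⟨Finset.singleton_nonempty v, by simpa using hv, fun f hf hfsub => ?_⟩
    have h1 := Set.ncard_le_ncard hfsub (Finset.finite_toSet _)
    have h2 := hcard f hf
    simp at h1
    omega
  have hstar : ∀ s, s ∈ (X.closedStar {v}).faces ↔ s.Nonempty ∧ s ∪ {v} ∈ X.faces := fun s => by
    rw [← Finset.coe_singleton, mem_faces_closedStar]
  have hstarX : ∀ s ∈ (X.closedStar {v}).faces, s ∈ X.faces := fun s hs =>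
    (X.isRelLowerSet_faces ((hstar s).mp hs).2).2 Finset.subset_union_left ((hstar s).mp hs).1
  have : ContractibleSpace (X.closedStar {v}).realization := by
    refine contractibleSpace_of_cone _ (fun s hs => hV s (hstarX s hs)) (v := v) ?_ fun s hs => ?_
    · exact (hstar _).mpr ⟨Finset.singleton_nonempty v, by simpa using hvX⟩
    · refine (hstar _).mpr ⟨Finset.insert_nonempty v s, ?_⟩
      have := ((hstar s).mp hs).2
      rwa [show insert v s ∪ {v} = s ∪ {v} by ext; simp]
  have : ContractibleSpace (⨆ i, X.closedStar (σ i : Set α)).realization :=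
    contractibleSpace_iSup_closedStar hV σ hσX fun τ S hS h => by
      convert Hypergraph.union_biUnion_mem_faces_independenceComplex hcyc (fun i : κ => i.1)
        (fun i => i.2.1) (fun i => i.2.2) σ hσ τ S hS (fun i hi => by convert h i hi)
  refine nonempty_homotopyEquiv_suspension_inf hV
    (PreAbstractSimplicialComplex.ext (Set.ext fun s => ⟨fun hs => ?_, ?_⟩))
  · by_cases hsv : s ∪ {v} ∈ X.faces
    · exact Or.inl ((hstar s).mpr ⟨hs.1, hsv⟩)
    -- Some edge lies in `s ∪ {v}` but not in `s`: it contains `v`, and `s` lies in its star.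
    · refine Or.inr (mem_faces_iSup.mpr ?_)
      have : ∃ e ∈ H.edgeSet, e ⊆ ((s ∪ {v} : Finset α) : Set α) := by
        by_contra hno
        refine hsv ⟨hs.1.mono Finset.subset_union_left, ?_, fun e he h => hno ⟨e, he, h⟩⟩
        rw [Finset.coe_union, Finset.coe_singleton]
        exact Set.union_subset hs.2.1 (Set.singleton_subset_iff.mpr hv)
      obtain ⟨e, he, hes⟩ := this
      have hve : v ∈ e := by
        by_contra hve
        refine hs.2.2 e he fun a ha => ?_
        have := hes ha
        simp only [Finset.coe_union, Finset.coe_singleton, Set.mem_union, Finset.mem_coe,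
          Set.mem_singleton_iff] at this
        exact this.resolve_right fun h => hve (h ▸ ha)
      refine ⟨⟨e, he, hve⟩, mem_faces_closedStar.mpr ⟨hs.1, ?_⟩⟩
      rwa [Finset.union_eq_left.mpr]
      rw [← Finset.coe_subset, hσ]
      rintro a ⟨ha, hav⟩
      have := hes ha
      simp only [Finset.coe_union, Finset.coe_singleton, Set.mem_union, Finset.mem_coe] at this
      exact this.resolve_right hav
  · rintro (hs | hs)
    · exact hstarX s hs
    · obtain ⟨i, hs⟩ := mem_faces_iSup.mp hs
      rw [mem_faces_closedStar] at hs
      exact (X.isRelLowerSet_faces hs.2).2 Finset.subset_union_left hs.1
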